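/- **Definitions.** For a positive integer $N$ write $[N]=\{1,\dots,N\}$. A *perfect matching* of size $N$ is a permutation of $[N]$ all of whose orbits have length $2$. A permutation $\sigma$ of $[N]$ is *indecomposable* if there is no $k$ with $0<k<N$ and $\sigma([k])=[k]$. Let $\mathfrak{im}_N$ be the number of indecomposable perfect matchings of size $N$. A *combinatorial map* of size $N$ is a pair $(\sigma,\alpha)$ of permutations of $[N]$ such that $\alpha$ is a perfect matching (the cycles of $\sigma$ are polygons with sides labeled by $[N]$, and $\alpha$ says which sides are glued together); it is *connected* if the group generated by $\sigma$ and $\alpha$ acts transitively on $[N]$. A *linear matching* of size $N$ is a pair $(<_1,<_2)$ of linear orders on $[N]$ for which there is an involution $\tau$ of $[N]$ without fixed points such that relabeling by $\tau$ transforms $(<_1,<_2)$ into $(<_2,<_1)$. It is *reducible* if there is a partition $[N]=A\sqcup B$ into two nonempty parts such that $a<_1b$ and $a<_2b$ for all $(a,b)\in A\times B$, and *irreducible* otherwise. Let $\mathfrak{ilm}_N$ be the number of irreducible linear matchings of size $N$. For a sequence $(a_n)$ and functions $f_0,f_1,\dots$ of $n$, write $a_n\approx\sum_{k\ge 0}f_k(n)$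 if, as $n\to\infty$, $a_n=\sum_{k=0}^{r}f_k(n)+O\big(f_{r+1}(n)\big)$ for every $r\ge 0$ and $f_{k+1}(n)=o\big(f_k(n)\big)$ for every $k\ge 0$; the notation $a_n\approx 1-\sum_{k\ge 1}g_k(n)$ means this with $f_0=1$ and $f_k=-g_k$ for $k\ge 1$. **Proposition.** Let $m$ be a uniformly random combinatorial map of size $2n$. Then $$\mathbb P(m\text{ is connected})\;\approx\;1-\sum_{k\ge 1}\frac{\mathfrak{ilm}_{2k}}{(2k)!}\cdot\frac{(2(n-k)-1)!!}{(2n-1)!!}$$ and $$\mathbb P(m\text{ is connected})\;\approx\;1-\sum_{k\ge 1}\mathfrak{im}_{2k}\cdot\frac{(2(n-k)-1)!!}{(2n-1)!!}.$$ -/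

import Mathlib

open Filter Asymptotics
open scoped Nat

namespace MapAsymptotics

/-! ### Asymptotic expansions -/

/-- `a n ≈ ∑_{k ≥ m} f k n`: for every `r ≥ m`, `a n = ∑_{k = m}^{r} f k n + O (f (r + 1) n)`,
and for every `k ≥ m`, `f (k + 1) n = o (f k n)`, as `n → ∞`. -/
def HasAsymptoticExpansion (a : ℕ → ℝ) (m : ℕ) (f : ℕ → ℕ → ℝ) : Prop :=
  (∀ r, m ≤ r → (fun n => a n - ∑ k ∈ Finset.Icc m r, f k n) =O[atTop] f (r + 1)) ∧
    ∀ k, m ≤ k → f (k + 1) =o[atTop] f k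

/-! ### Perfect matchings and combinatorial maps -/

/-- A perfect matching on `Fin n`: a permutation all of whose orbits have length `2`. -/
def IsPerfectMatching {n : ℕ} (α : Equiv.Perm (Fin n)) : Prop :=
  ∀ i, {j | α.SameCycle i j}.ncard = 2

/-- Perfect matchings are exactly the involutions without fixed points. -/
theorem isPerfectMatching_iff {n : ℕ} (α : Equiv.Perm (Fin n)) :
    IsPerfectMatching α ↔ Function.Involutive α ∧ ∀ i, α i ≠ i := by
  constructor
  · intro h
    have hne : ∀ i, α i ≠ i := by
      intro i hi
      have h1 : {j | α.SameCycle i j} = {i} := by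
        ext j
        simp only [Set.mem_ofPred_eq, Set.mem_singleton_iff]
        constructor
        · intro hj
          exact (hj.eq_of_left hi).symm
        · rintro rfl
          exact Equiv.Perm.SameCycle.refl _ _
      have h2 := h i
      rw [h1, Set.ncard_singleton] at h2
      omega
    refine ⟨fun i => ?_, hne⟩
    by_contra hi
    have hsub : ({i, α i, α (α i)} : Set (Fin n)) ⊆ {j | α.SameCycle i j} := by
      intro j hj
      simp only [Set.mem_insert_iff, Set.mem_singleton_iff] at hj
      rcases hj with rfl | rfl | rfl
      · exact Equiv.Perm.SameCycle.refl _ _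
      · exact ⟨1, by simp⟩
      · exact ⟨2, by simp [zpow_ofNat, pow_two]⟩
    have h3 : ({i, α i, α (α i)} : Set (Fin n)).ncard = 3 :=
      Set.ncard_eq_three.2 ⟨_, _, _, (hne i).symm, fun e => hi e.symm, (hne (α i)).symm, rfl⟩
    have h4 := Set.ncard_le_ncard hsub (Set.toFinite _)
    rw [h3, h i] at h4
    omega
  · rintro ⟨hinv, hne⟩ i
    have h1 : {j | α.SameCycle i j} = {i, α i} := by
      ext j
      simp only [Set.mem_ofPred_eq, Set.mem_insert_iff, Set.mem_singleton_iff]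
      constructor
      · rintro ⟨z, rfl⟩
        have hsq : α ^ (2 : ℤ) = 1 := by
          ext x
          simp [zpow_ofNat, pow_two, hinv x]
        rcases Int.even_or_odd' z with ⟨c, rfl | rfl⟩
        · left
          simp [zpow_mul, hsq]
        · right
          simp [zpow_add, zpow_mul, hsq]
      · rintro (rfl | rfl)
        · exact Equiv.Perm.SameCycle.refl _ _
        · exact ⟨1, by simp⟩
    rw [h1, Set.ncard_pair (hne i).symm]

/-- A combinatorial map of size `n`: a pair of permutations `(σ, α)` of the `n` labels such that
`α` is a perfect matching.  The cycles of `σ` list the sides of the polygons in cyclic order, and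
those of `α` are the pairs of sides that are glued. -/
@[ext]
structure CombinatorialMap (n : ℕ) where
  σ : Equiv.Perm (Fin n)
  α : Equiv.Perm (Fin n)
  isPerfectMatching : IsPerfectMatching α

instance (n : ℕ) : Finite (CombinatorialMap n) :=
  Finite.of_injective (fun m : CombinatorialMap n => (m.σ, m.α)) fun _ _ h =>
    CombinatorialMap.ext (congrArg Prod.fst h) (congrArg Prod.snd h)

/-- The map is connected: it is nonempty, and any side can be reached from any other by moving
around polygons and across glued sides, i.e. the group generated by `σ` and `α` is transitive. -/
def CombinatorialMap.IsConnected {n : ℕ} (m : CombinatorialMap n) : Prop :=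
  0 < n ∧ MulAction.IsPretransitive (Subgroup.closure {m.σ, m.α}) (Fin n)

/-- The probability that a uniformly random combinatorial map of size `n` is connected. -/
noncomputable def probConnected (n : ℕ) : ℝ :=
  (Nat.card {m : CombinatorialMap n // m.IsConnected} : ℝ) / (Nat.card (CombinatorialMap n) : ℝ)

/-! ### Indecomposable perfect matchings -/

/-- `σ` is indecomposable: it maps no proper nonempty initial segment of the labels to itself. -/
def IsIndecomposable {n : ℕ} (σ : Equiv.Perm (Fin n)) : Prop :=
  ¬ ∃ k, 0 < k ∧ k < n ∧ σ '' {i : Fin n | (i : ℕ) < k} = {i : Fin n | (i : ℕ) < k}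

/-- The number of indecomposable perfect matchings of size `n`. -/
noncomputable def im (n : ℕ) : ℕ :=
  Nat.card {α : Equiv.Perm (Fin n) // IsPerfectMatching α ∧ IsIndecomposable α}

/-! ### Irreducible linear matchings -/

/-- (Strict) linear orders on the label set `Fin n`. -/
def LinOrd (n : ℕ) : Type :=
  {r : Fin n → Fin n → Prop // IsStrictTotalOrder (Fin n) r}

instance (n : ℕ) : Finite (LinOrd n) :=
  inferInstanceAs (Finite {r : Fin n → Fin n → Prop // IsStrictTotalOrder (Fin n) r})

/-- `IsRelabeling τ r s`: relabeling every label `i` as `τ i` turns the order `r` into `s`. -/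
def IsRelabeling {n : ℕ} (τ : Equiv.Perm (Fin n)) (r s : LinOrd n) : Prop :=
  ∀ i j, s.1 (τ i) (τ j) ↔ r.1 i j

/-- A pair of linear orders `(<₁, <₂)` is a linear matching if `(<₂, <₁)` is obtained from it by a
relabeling that is an involution without fixed points. -/
def IsLinearMatching {n : ℕ} (L : LinOrd n × LinOrd n) : Prop :=
  ∃ τ : Equiv.Perm (Fin n), Function.Involutive τ ∧ (∀ i, τ i ≠ i) ∧
    IsRelabeling τ L.1 L.2 ∧ IsRelabeling τ L.2 L.1

/-- A pair of linear orders is reducible if the labels split into two nonempty parts `A` and `B`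
such that every element of `A` is below every element of `B` for both orders. -/
def IsReducible {n : ℕ} (L : LinOrd n × LinOrd n) : Prop :=
  ∃ A B : Set (Fin n), A.Nonempty ∧ B.Nonempty ∧ IsCompl A B ∧
    ∀ a ∈ A, ∀ b ∈ B, L.1.1 a b ∧ L.2.1 a b

/-- The number of irreducible linear matchings of size `n`. -/
noncomputable def ilm (n : ℕ) : ℕ :=
  Nat.card {L : LinOrd n × LinOrd n // IsLinearMatching L ∧ ¬ IsReducible L}

end MapAsymptotics

open MapAsymptotics

/-! Let `A = ∑ (2n - 1)‼ xⁿ`. Cutting a perfect matching at its shortest nonempty invariant initial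
segment gives `A = 1 / B` with `B = 1 - ∑ im (2k) xᵏ` (`matchSeq_eq_sum_im`). There are `(2n)! (2n -
1)‼` maps of size `2n`, so `A` is also their exponential generating function, and isolating the
component of one label gives `A = exp L`, where `L` counts connected maps (`mul_matchSeq_eq_sum`).
The probability of connectedness is thus the `n`-th coefficient of `L` divided by `(2n - 1)‼`.

Since the coefficients of `A` grow factorially, those of a function of `A` are governed by its
derivative at `A`. The derivative of `log` at `A` is `1 / A = B`, so the coefficients of `L` should
behave like those of `B * A`, with `B` truncated: this is the second expansion. The rigorous form is
`isFactorialO_log_sub`. It uses the equation `A = 1 + xA + 2x²A'`, which expresses `L'` through `B`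
and so reduces the logarithm to the inverse treated in `isFactorialO_inv_add`.

The first expansion has the same terms: a pair of linear orders is a permutation `ρ` together with
the relative permutation `α` between the two orders. The choice of `ρ` is free, and the conditions
on the pair are conditions on `α` alone, whence `ilm_eq`. -/

namespace MapAsymptotics

open PowerSeries

/-! ### The sequence `(2n - 1)‼` and factorially bounded power series -/

/-- The number `(2n - 1)‼` of perfect matchings of size `2n`, as a real number. -/
noncomputable def matchSeq (n : ℕ) : ℝ := ((2 * n - 1)‼ : ℝ)

theorem matchSeq_zero : matchSeq 0 = 1 := by simp [matchSeq]

theorem matchSeq_succ (n : ℕ) : matchSeq (n + 1) = (2 * n + 1) * matchSeq n := by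
  unfold matchSeq
  rw [show 2 * (n + 1) - 1 = 2 * n + 1 by omega, Nat.doubleFactorial_add_one]
  push_cast
  ring

theorem matchSeq_pos (n : ℕ) : 0 < matchSeq n := by
  unfold matchSeq
  exact_mod_cast Nat.doubleFactorial_pos _

theorem monotone_matchSeq : Monotone matchSeq := by
  refine monotone_nat_of_le_succ fun n => ?_
  rw [matchSeq_succ]
  nlinarith [matchSeq_pos n, (Nat.cast_nonneg n : (0 : ℝ) ≤ n)]

/-- Log-convexity: moving two indices apart at constant sum increases the product. It makes the
extreme terms of a convolution dominate. -/
theorem matchSeq_mul_le (R s t : ℕ) :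
    matchSeq (R + s) * matchSeq (R + t) ≤ matchSeq R * matchSeq (R + s + t) := by
  induction s with
  | zero => simp
  | succ s ih =>
    rw [← add_assoc, matchSeq_succ, show R + s + 1 + t = R + s + t + 1 by ring, matchSeq_succ]
    have h1 : ((2 * ((R + s : ℕ) : ℝ) + 1)) ≤ 2 * ((R + s + t : ℕ) : ℝ) + 1 := by
      push_cast
      linarith [(Nat.cast_nonneg t : (0 : ℝ) ≤ t)]
    calc _ = (2 * ((R + s : ℕ) : ℝ) + 1) * (matchSeq (R + s) * matchSeq (R + t)) := by ring
      _ ≤ (2 * ((R + s + t : ℕ) : ℝ) + 1) * (matchSeq R * matchSeq (R + s + t)) :=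
        mul_le_mul h1 ih (mul_nonneg (matchSeq_pos _).le (matchSeq_pos _).le) (by positivity)
      _ = _ := by ring

theorem tendsto_matchSeq_ratio :
    Tendsto (fun n => matchSeq n / matchSeq (n + 1)) atTop (nhds 0) := by
  have h : (fun n => matchSeq n / matchSeq (n + 1)) = fun n : ℕ => (2 * (n : ℝ) + 1)⁻¹ := by
    ext n
    rw [matchSeq_succ]
    have := (matchSeq_pos n).ne'
    field_simp
  rw [h]
  refine tendsto_inv_atTop_zero.comp (tendsto_atTop_add_const_right _ _ ?_)
  exact Tendsto.const_mul_atTop (by norm_num) tendsto_natCast_atTop_atTop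

/-- The coefficients of `F` are `O((2(n - R) - 1)‼)`. -/
def IsFactorialO (R : ℕ) (F : ℝ⟦X⟧) : Prop :=
  (fun n => coeff n F) =O[atTop] fun n => matchSeq (n - R)

namespace IsFactorialO

variable {R : ℕ} {F G : ℝ⟦X⟧}

theorem add (hF : IsFactorialO R F) (hG : IsFactorialO R G) : IsFactorialO R (F + G) := by
  simpa [IsFactorialO] using IsBigO.add hF hG

theorem sub (hF : IsFactorialO R F) (hG : IsFactorialO R G) : IsFactorialO R (F - G) := by
  simpa [IsFactorialO] using IsBigO.sub hF hG

theorem const_mul (c : ℝ) (hF : IsFactorialO R F) : IsFactorialO R (C c * F) := by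
  simpa [IsFactorialO] using IsBigO.const_mul_left hF c

theorem X_pow_mul (k : ℕ) (hF : IsFactorialO R F) : IsFactorialO (R + k) (X ^ k * F) := by
  unfold IsFactorialO at *
  have h := hF.comp_tendsto (tendsto_sub_atTop_nat k)
  refine (h.congr' ?_ ?_)
  · filter_upwards [eventually_ge_atTop k] with n hn
    simp [coeff_X_pow_mul', hn]
  · filter_upwards with n
    simp [Nat.sub_sub, add_comm]

theorem mono {S : ℕ} (h : R ≤ S) (hF : IsFactorialO S F) : IsFactorialO R F := by
  refine IsBigO.trans hF (IsBigO.of_bound 1 (Eventually.of_forall fun n => ?_))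
  rw [Real.norm_of_nonneg (matchSeq_pos _).le, Real.norm_of_nonneg (matchSeq_pos _).le, one_mul]
  exact monotone_matchSeq (by omega)

theorem polynomial_mul (p : Polynomial ℝ) (hF : IsFactorialO R F) :
    IsFactorialO R ((p : ℝ⟦X⟧) * F) := by
  induction p using Polynomial.induction_on' with
  | add p q hp hq => simpa [add_mul] using hp.add hq
  | monomial n c =>
    rw [Polynomial.coe_monomial, PowerSeries.monomial_eq_C_mul_X_pow, mul_assoc]
    exact (mono (Nat.le_add_right R n) (hF.X_pow_mul n)).const_mul c

theorem of_polynomial (p : Polynomial ℝ) : IsFactorialO R (p : ℝ⟦X⟧) := by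
  refine (isBigO_zero (E' := ℝ) (fun n => matchSeq (n - R)) atTop).congr' ?_ EventuallyEq.rfl
  filter_upwards [eventually_gt_atTop p.natDegree] with n hn
  rw [Polynomial.coeff_coe, Polynomial.coeff_eq_zero_of_natDegree_lt hn]

theorem polynomial_mul_of_dvd {p : Polynomial ℝ} (hp : Polynomial.X ^ R ∣ p)
    (hF : IsFactorialO 0 F) : IsFactorialO R ((p : ℝ⟦X⟧) * F) := by
  obtain ⟨q, rfl⟩ := hp
  have := (hF.polynomial_mul q).X_pow_mul R
  simpa [mul_assoc] using this

/-- A product of two series of order at least `R` with coefficients bounded by `(2n - 1)‼`. -/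
theorem mul_of_order (hF0 : ∀ n < R, coeff n F = 0) (hG0 : ∀ n < R, coeff n G = 0)
    (hF : ∀ n, |coeff n F| ≤ matchSeq n) (hG : ∀ n, |coeff n G| ≤ matchSeq n) :
    IsFactorialO R (F * G) := by
  -- The two end terms of the convolution give `2 * matchSeq R`. Each of the at most `n + 1` others
  -- is bounded through log-convexity by `matchSeq (R + 1) * matchSeq (n - R - 1)`, and `n ≥ 2R + 2`
  -- makes `n + 1` copies of `matchSeq (n - R - 1)` fit into `matchSeq (n - R)`.
  refine IsBigO.of_bound (2 * matchSeq R + matchSeq (R + 1)) ?_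
  filter_upwards [eventually_ge_atTop (2 * R + 2)] with n hn
  rw [Real.norm_of_nonneg (matchSeq_pos _).le, coeff_mul, Real.norm_eq_abs]
  set a := matchSeq with ha
  have hterm : ∀ ij ∈ Finset.HasAntidiagonal.antidiagonal n, |coeff ij.1 F * coeff ij.2 G| ≤
      (if ij.1 = R then a R * a (n - R) else 0) + (if ij.2 = R then a R * a (n - R) else 0) +
        a (R + 1) * a (n - R - 1) := by
    rintro ⟨i, j⟩ hij
    rw [Finset.HasAntidiagonal.mem_antidiagonal] at hij
    dsimp only at hij ⊢
    have h1 : 0 ≤ a R * a (n - R) := mul_nonneg (matchSeq_pos _).le (matchSeq_pos _).le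
    have h2 : 0 ≤ a (R + 1) * a (n - R - 1) := mul_nonneg (matchSeq_pos _).le (matchSeq_pos _).le
    rw [abs_mul]
    have h3 : |coeff i F| * |coeff j G| ≤ a i * a j :=
      mul_le_mul (hF i) (hG j) (abs_nonneg _) (matchSeq_pos _).le
    rcases lt_or_ge i R with hi | hi
    · rw [hF0 i hi]
      split_ifs <;> simp <;> linarith
    rcases lt_or_ge j R with hj | hj
    · rw [hG0 j hj]
      split_ifs <;> simp <;> linarith
    rcases eq_or_lt_of_le hi with hi | hi
    · subst hi
      rw [show n - R = j by omega] at *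
      rw [if_pos rfl]
      split_ifs <;> linarith
    rcases eq_or_lt_of_le hj with hj | hj
    · subst hj
      rw [show n - R = i by omega] at *
      rw [if_pos rfl, if_neg hi.ne']
      linarith [mul_comm (a i) (a R)]
    have h4 := matchSeq_mul_le (R + 1) (i - (R + 1)) (j - (R + 1))
    rw [show R + 1 + (i - (R + 1)) = i by omega, show R + 1 + (j - (R + 1)) = j by omega,
      show i + (j - (R + 1)) = n - R - 1 by omega] at h4
    split_ifs <;> linarith
  refine (Finset.abs_sum_le_sum_abs _ _).trans ((Finset.sum_le_sum hterm).trans ?_)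
  rw [Finset.sum_add_distrib, Finset.sum_add_distrib, Finset.sum_const,
    Finset.Nat.card_antidiagonal]
  have e1 : ∑ ij ∈ Finset.HasAntidiagonal.antidiagonal n, (if ij.1 = R then a R * a (n - R) else 0) =
      a R * a (n - R) := by
    rw [Finset.Nat.sum_antidiagonal_eq_sum_range_succ
      (fun i _ => if i = R then a R * a (n - R) else 0), Finset.sum_ite_eq', if_pos]
    simp; omega
  have e2 : ∑ ij ∈ Finset.HasAntidiagonal.antidiagonal n, (if ij.2 = R then a R * a (n - R) else 0) =
      a R * a (n - R) := by
    rw [← Finset.Nat.sum_antidiagonal_swap]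
    exact e1
  rw [e1, e2]
  have h5 : a (n - R) = (2 * ((n - R - 1 : ℕ) : ℝ) + 1) * a (n - R - 1) := by
    rw [ha, ← matchSeq_succ]
    congr 1
    omega
  have h6 : ((n + 1 : ℕ) : ℝ) ≤ 2 * ((n - R - 1 : ℕ) : ℝ) + 1 := by
    have : n + 1 ≤ 2 * (n - R - 1) + 1 := by omega
    exact_mod_cast this
  have h7 : ((n + 1 : ℕ) : ℝ) * a (n - R - 1) ≤ a (n - R) := by
    rw [h5]
    exact mul_le_mul_of_nonneg_right h6 (matchSeq_pos _).le
  have h8 := mul_le_mul_of_nonneg_left h7 (matchSeq_pos (R + 1)).le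
  rw [nsmul_eq_mul]
  nlinarith

end IsFactorialO

/-! ### Coefficients of the logarithm of `∑ (2n - 1)‼ xⁿ` -/

/-- First-order expansion of the inverse, whose derivative at `A` is `-B²`. The product of the tails
of `A` and `B` beyond degree `R` is negligible; expanding it, multiplying by the truncation of `B`
and using `A * B = 1` leaves the claim up to a polynomial and a multiple of `x^R B`. -/
theorem isFactorialO_inv_add {A B : ℝ⟦X⟧} (hA : ∀ n, coeff n A = matchSeq n)
    (hB : ∀ n, |coeff n B| ≤ matchSeq n) (hAB : A * B = 1) (R : ℕ) :
    IsFactorialO R (B + (trunc R B : ℝ⟦X⟧) ^ 2 * A) := by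
  have hB0 : IsFactorialO 0 B := by
    refine IsBigO.of_bound 1 (Eventually.of_forall fun n => ?_)
    rw [Real.norm_of_nonneg (matchSeq_pos _).le, one_mul]
    exact hB n
  have habs : ∀ n, |coeff n A| ≤ matchSeq n := fun n => by
    rw [hA, abs_of_pos (matchSeq_pos n)]
  have hhigh : IsFactorialO R ((A - (trunc R A : ℝ⟦X⟧)) * (B - (trunc R B : ℝ⟦X⟧))) := by
    refine IsFactorialO.mul_of_order ?_ ?_ ?_ ?_
    · intro n hn
      simp [coeff_trunc, hn]
    · intro n hn
      simp [coeff_trunc, hn]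
    · intro n
      rw [map_sub, Polynomial.coeff_coe, coeff_trunc]
      split_ifs
      · simpa using (matchSeq_pos n).le
      · simpa using habs n
    · intro n
      rw [map_sub, Polynomial.coeff_coe, coeff_trunc]
      split_ifs
      · simpa using (matchSeq_pos n).le
      · simpa using hB n
  have hdvd : Polynomial.X ^ R ∣ (trunc R A * trunc R B - 1 : Polynomial ℝ) := by
    rw [Polynomial.X_pow_dvd_iff]
    intro d hd
    have h := congrArg (fun p => Polynomial.coeff p d) (trunc_trunc_mul_trunc (n := R) A B)
    simp only [coeff_trunc, if_pos hd, hAB] at h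
    rw [← Polynomial.coe_mul, Polynomial.coeff_coe] at h
    rw [Polynomial.coeff_sub, h]
    simp [coeff_one, Polynomial.coeff_one]
  have h1 := (hhigh.polynomial_mul (trunc R B)).add
    (IsFactorialO.polynomial_mul_of_dvd hdvd hB0)
  have h2 := (IsFactorialO.of_polynomial (R := R) (trunc R B * (trunc R A * trunc R B + 1))).sub h1
  convert h2 using 1
  push_cast
  linear_combination (trunc R B : ℝ⟦X⟧) * hAB

/-- With `q` the truncation of `B` and `G = L - qA`, the differential equations of `A` and `L` write
`2x²G'` as a polynomial, minus `B + q²A`, plus `(q² - 2x²q' - q + xq) A`. The last factor would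
vanish for `q = B`, hence is divisible by `x^R`. Integrating then gains back the factor of order `n`
lost to the shift by `x²`. -/
theorem isFactorialO_log_sub {A B L : ℝ⟦X⟧} (hA : ∀ n, coeff n A = matchSeq n)
    (hB : ∀ n, |coeff n B| ≤ matchSeq n) (hAB : A * B = 1)
    (hL : d⁄dX ℝ A = d⁄dX ℝ L * A) {R : ℕ} (hR : 0 < R) :
    IsFactorialO R (L - (trunc R B : ℝ⟦X⟧) * A) := by
  -- The recurrence `(2n + 1)‼ = (2n + 1) (2n - 1)‼` as a differential equation; it yields a Riccati
  -- equation for `B` (`hB'`) and a formula for `L'` (`hL'`).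
  have hA' : A = 1 + X * A + 2 * X ^ 2 * d⁄dX ℝ A := by
    ext n
    have h2 : (2 : ℝ⟦X⟧) = C (2 : ℝ) := (map_ofNat C 2).symm
    rw [map_add, map_add, hA, h2, mul_assoc, coeff_C_mul, coeff_X_pow_mul', coeff_one]
    rcases n with _ | _ | n
    · simp [matchSeq_zero]
    · simp [coeff_succ_X_mul, hA, matchSeq_zero, matchSeq_succ]
    · rw [coeff_succ_X_mul, hA, matchSeq_succ, if_neg (by omega), if_pos (by omega), coeff_derivative,
        show n + 1 + 1 - 2 + 1 = n + 1 by omega, hA, show n + 1 + 1 - 2 = n by omega]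
      push_cast
      ring
  have hAB' : d⁄dX ℝ A * B + A * d⁄dX ℝ B = 0 := by
    have := congrArg (d⁄dX ℝ) hAB
    simpa [Derivation.leibniz, add_comm, mul_comm] using this
  have hB' : 2 * X ^ 2 * d⁄dX ℝ B = B ^ 2 - B + X * B := by
    linear_combination (2 * X ^ 2 * B) * hAB' - (2 * X ^ 2 * d⁄dX ℝ B + B - X * B) * hAB + B ^ 2 * hA'
  have hL' : 2 * X ^ 2 * d⁄dX ℝ L = 1 - B - X := by
    linear_combination (-2 * X ^ 2 * d⁄dX ℝ L + 1 - X) * hAB - (2 * X ^ 2 * B) * hL - B * hA'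
  have hA0 : IsFactorialO 0 A := by
    refine IsBigO.of_bound 1 (Eventually.of_forall fun n => ?_)
    simp [hA]
  set q : Polynomial ℝ := trunc R B with hq
  have hdvd : Polynomial.X ^ R ∣ (q ^ 2 - (Polynomial.X ^ 2 * Polynomial.derivative q +
      Polynomial.X ^ 2 * Polynomial.derivative q) - q +
      Polynomial.X * q : Polynomial ℝ) := by
    rw [Polynomial.X_pow_dvd_iff]
    simp_rw [← Polynomial.coeff_coe]
    rw [← PowerSeries.X_pow_dvd_iff]
    push_cast
    rw [← derivative_coe]
    obtain ⟨H, hH⟩ : X ^ R ∣ B - (q : ℝ⟦X⟧) := by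
      rw [PowerSeries.X_pow_dvd_iff]
      intro m hm
      simp [hq, coeff_trunc, hm]
    -- Differentiation lowers the order by one, which the factor `X ^ 2` more than restores.
    have hH' : X ^ R ∣ X ^ 2 * d⁄dX ℝ (B - (q : ℝ⟦X⟧)) := by
      rw [PowerSeries.X_pow_dvd_iff]
      intro m hm
      rw [coeff_X_pow_mul']
      split_ifs with h
      · rw [coeff_derivative, map_sub, Polynomial.coeff_coe, hq, coeff_trunc,
          if_pos (by omega), sub_self, zero_mul]
      · rfl
    have key : (q : ℝ⟦X⟧) ^ 2 - (X ^ 2 * d⁄dX ℝ (q : ℝ⟦X⟧) + X ^ 2 * d⁄dX ℝ (q : ℝ⟦X⟧)) - (q : ℝ⟦X⟧) +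
        X * (q : ℝ⟦X⟧) =
        2 * (X ^ 2 * d⁄dX ℝ (B - (q : ℝ⟦X⟧))) + X ^ R * (H * (1 - X - (q : ℝ⟦X⟧) - B)) := by
      rw [map_sub]
      linear_combination (1 - X - (q : ℝ⟦X⟧) - B) * hH - hB'
    rw [key]
    exact dvd_add (hH'.mul_left _) (dvd_mul_right _ _)
  have h1 := ((IsFactorialO.of_polynomial (R := R) (1 - Polynomial.X + q)).sub
    (isFactorialO_inv_add hA hB hAB R)).add (IsFactorialO.polynomial_mul_of_dvd hdvd hA0)
  have h2 : IsFactorialO R (2 * X ^ 2 * d⁄dX ℝ (L - (q : ℝ⟦X⟧) * A)) := by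
    convert h1 using 1
    rw [map_sub, Derivation.leibniz, smul_eq_mul, smul_eq_mul]
    push_cast
    rw [← derivative_coe]
    linear_combination hL' + (q : ℝ⟦X⟧) * hA'
  set G := L - (q : ℝ⟦X⟧) * A
  have h3 := IsBigO.comp_tendsto h2 (tendsto_add_atTop_nat 1)
  obtain ⟨c, hc⟩ := h3.bound
  refine IsBigO.of_bound c ?_
  filter_upwards [hc, eventually_ge_atTop R] with n hn hnR
  obtain ⟨m, rfl⟩ : ∃ m, n = m + 1 := ⟨n - 1, by omega⟩
  have h4 : coeff (m + 1 + 1) (2 * X ^ 2 * d⁄dX ℝ G) = 2 * ((m : ℝ) + 1) * coeff (m + 1) G := by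
    rw [show (2 : ℝ⟦X⟧) = C (2 : ℝ) from (map_ofNat C 2).symm, mul_assoc, coeff_C_mul, coeff_X_pow_mul',
      if_pos (by omega), coeff_derivative, show m + 1 + 1 - 2 = m by omega]
    ring
  simp only [Function.comp] at hn
  rw [h4, show m + 1 + 1 - R = (m + 1 - R) + 1 by omega, matchSeq_succ, norm_mul,
    norm_mul _ (matchSeq _), Real.norm_of_nonneg (show 0 ≤ 2 * ((m : ℝ) + 1) by positivity),
    Real.norm_of_nonneg (show 0 ≤ 2 * ((m + 1 - R : ℕ) : ℝ) + 1 by positivity)] at hn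
  -- This is where `0 < R` matters: for `R = 0` the left side is larger by one.
  have hm : (2 * ((m + 1 - R : ℕ) : ℝ) + 1) ≤ 2 * ((m : ℝ) + 1) := by
    have : 2 * (m + 1 - R) + 1 ≤ 2 * (m + 1) := by omega
    exact_mod_cast this
  -- The constant extracted from the big-O bound has no prescribed sign.
  have hc0 : 0 ≤ c * ‖matchSeq (m + 1 - R)‖ := by
    by_contra hneg
    have h5 : c * ((2 * ((m + 1 - R : ℕ) : ℝ) + 1) * ‖matchSeq (m + 1 - R)‖) < 0 := by
      have : (0 : ℝ) < 2 * ((m + 1 - R : ℕ) : ℝ) + 1 := by positivity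
      nlinarith
    have h6 : 0 ≤ 2 * ((m : ℝ) + 1) * ‖coeff (m + 1) G‖ := by positivity
    linarith
  refine le_of_mul_le_mul_left (a := 2 * ((m : ℝ) + 1)) ?_ (by positivity)
  nlinarith

/-- If `∑ (2n - 1)‼ xⁿ = 1 / B = exp L`, then the coefficients of `L` are asymptotic to those of
`B` times `∑ (2n - 1)‼ xⁿ`, taken term by term. -/
theorem isBigO_log_coeff {b c : ℕ → ℝ}
    (hb : ∀ n, |b n| ≤ matchSeq n)
    (hab : ∀ n : ℕ, ∑ k ∈ Finset.range (n + 1), b k * matchSeq (n - k) = if n = 0 then 1 else 0)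
    (hc : ∀ n : ℕ, (n : ℝ) * matchSeq n = ∑ k ∈ Finset.range (n + 1), k * c k * matchSeq (n - k))
    {R : ℕ} (hR : 0 < R) :
    (fun n => c n - ∑ k ∈ Finset.range R, b k * matchSeq (n - k)) =O[atTop]
      fun n => matchSeq (n - R) := by
  have hAB : PowerSeries.mk matchSeq * PowerSeries.mk b = 1 := by
    ext n
    rw [mul_comm, coeff_mul, coeff_one, ← hab n,
      Finset.Nat.sum_antidiagonal_eq_sum_range_succ_mk]
    simp
  have hL : d⁄dX ℝ (PowerSeries.mk matchSeq) =
      d⁄dX ℝ (PowerSeries.mk c) * PowerSeries.mk matchSeq := by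
    ext n
    have h := hc (n + 1)
    rw [Finset.sum_range_succ'] at h
    rw [coeff_mul, Finset.Nat.sum_antidiagonal_eq_sum_range_succ_mk, coeff_derivative]
    simp only [coeff_mk, coeff_derivative]
    push_cast at h
    rw [mul_comm, h]
    simp [mul_comm]
  refine (isFactorialO_log_sub (by simp) (by simpa using hb) hAB hL hR).congr' ?_ EventuallyEq.rfl
  filter_upwards [eventually_ge_atTop R] with n hn
  rw [map_sub, coeff_mul, Finset.Nat.sum_antidiagonal_eq_sum_range_succ_mk]
  simp only [coeff_mk, Polynomial.coeff_coe, coeff_trunc, ite_mul, zero_mul]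
  congr 1
  rw [← Finset.sum_filter]
  congr 1
  ext k
  simp
  omega

end MapAsymptotics

namespace MapAsymptotics

open Equiv

/-! ### Counting by cases -/

theorem card_subtype_eq_sum {X ι : Type*} [Finite X] (s : Finset ι) (Q : X → Prop)
    (P : ι → X → Prop) (h : ∀ x, Q x → ∃! i, i ∈ s ∧ P i x) :
    Nat.card {x // Q x} = ∑ i ∈ s, Nat.card {x // Q x ∧ P i x} := by
  classical
  have := Fintype.ofFinite X
  rcases isEmpty_or_nonempty ι with hι | hι
  · have hQ : ∀ x, ¬ Q x := fun x hx => isEmptyElim (h x hx).choose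
    simp [Finset.eq_empty_of_isEmpty s, hQ]
  choose! f hf hfu using h
  simp only [Nat.card_eq_fintype_card, Fintype.card_subtype]
  rw [Finset.card_eq_sum_card_fiberwise (f := f) (t := s)]
  · refine Finset.sum_congr rfl fun i hi => ?_
    rw [Finset.filter_filter]
    congr 1
    ext x
    simp only [Finset.mem_filter, Finset.mem_univ, true_and]
    refine and_congr_right fun hQ => ⟨?_, fun hP => (hfu x hQ i ⟨hi, hP⟩).symm⟩
    rintro rfl
    exact (hf x hQ).2
  · intro x hx
    exact (hf x (by simpa using hx)).1

theorem sum_range_two_mul {M : Type*} [AddCommMonoid M] (f : ℕ → M) (n : ℕ)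
    (hf : ∀ i, f (2 * i) = 0) :
    ∑ j ∈ Finset.range (2 * n), f j = ∑ i ∈ Finset.range n, f (2 * i + 1) := by
  induction n with
  | zero => simp
  | succ n ih =>
    rw [show 2 * (n + 1) = 2 * n + 1 + 1 by ring, Finset.sum_range_succ, Finset.sum_range_succ, ih,
      hf, add_zero, Finset.sum_range_succ]

/-! ### Permutations preserving a block -/

/-- The permutation acting as `β` on the first block and as `γ` on the second one. -/
def blockPerm {A B X : Type*} (e : A ⊕ B ≃ X) (β : Perm A) (γ : Perm B) : Perm X :=
  e.permCongr (Perm.sumCongr β γ)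

section blockPerm

variable {A B X : Type*} (e : A ⊕ B ≃ X) (β : Perm A) (γ : Perm B)

@[simp] theorem blockPerm_inl (a : A) : blockPerm e β γ (e (Sum.inl a)) = e (Sum.inl (β a)) := by
  simp [blockPerm]

@[simp] theorem blockPerm_inr (b : B) : blockPerm e β γ (e (Sum.inr b)) = e (Sum.inr (γ b)) := by
  simp [blockPerm]

variable {β γ} in
theorem blockPerm_inj {β' : Perm A} {γ' : Perm B} (h : blockPerm e β γ = blockPerm e β' γ') :
    β = β' ∧ γ = γ' := by
  constructor
  · ext a
    have := congrArg (fun σ => σ (e (Sum.inl a))) h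
    simpa using this
  · ext b
    have := congrArg (fun σ => σ (e (Sum.inr b))) h
    simpa using this

/-- By finiteness, a permutation mapping the first block into itself maps it onto itself, and so
preserves the second block too. -/
theorem exists_eq_blockPerm [Finite A] [Finite B] (σ : Perm X)
    (h : ∀ a, ∃ a', σ (e (Sum.inl a)) = e (Sum.inl a')) : ∃ β γ, σ = blockPerm e β γ := by
  have hm : Set.MapsTo (e.symm.permCongr σ) (Set.range Sum.inl) (Set.range Sum.inl) := by
    rintro _ ⟨a, rfl⟩
    obtain ⟨a', ha'⟩ := h a
    exact ⟨a', by simp [Equiv.permCongr_apply, ha']⟩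
  obtain ⟨⟨β, γ⟩, hβγ⟩ := Perm.mem_sumCongrHom_range_of_perm_mapsTo_inl hm
  refine ⟨β, γ, ?_⟩
  have h2 : Perm.sumCongr β γ = e.symm.permCongr σ := hβγ
  rw [blockPerm, h2]
  ext x
  simp [Equiv.permCongr_apply]

end blockPerm

theorem isPerfectMatching_blockPerm {k m N : ℕ} (e : Fin k ⊕ Fin m ≃ Fin N) (β : Perm (Fin k))
    (γ : Perm (Fin m)) :
    IsPerfectMatching (blockPerm e β γ) ↔ IsPerfectMatching β ∧ IsPerfectMatching γ := by
  simp only [isPerfectMatching_iff, Function.Involutive, e.surjective.forall, Sum.forall,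
    blockPerm_inl, blockPerm_inr, e.injective.eq_iff, Sum.inl.injEq, Sum.inr.injEq, ne_eq]
  tauto

/-! ### The number of perfect matchings -/

/-- The number of perfect matchings of size `n`. -/
noncomputable def numMatchings (n : ℕ) : ℕ :=
  Nat.card {α : Perm (Fin n) // IsPerfectMatching α}

theorem IsPerfectMatching.cycleType {n : ℕ} {α : Perm (Fin n)} (h : IsPerfectMatching α) :
    ∃ k, n = 2 * k ∧ α.cycleType = Multiset.replicate k 2 := by
  rw [isPerfectMatching_iff] at h
  have h2 : α ^ 2 = 1 := by
    ext x
    simp [pow_two, h.1 x]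
  have : Fact (Nat.Prime 2) := ⟨Nat.prime_two⟩
  have h3 := Perm.cycleType_of_pow_prime_eq_one h2
  have h4 : α.support = Finset.univ := by
    ext x
    simp [h.2 x]
  have h5 := α.sum_cycleType
  rw [h3, h4] at h5
  simp only [Multiset.sum_replicate, smul_eq_mul, Finset.card_univ, Fintype.card_fin] at h5
  exact ⟨_, by omega, h3⟩

theorem isPerfectMatching_of_cycleType {n : ℕ} {α : Perm (Fin (2 * n))}
    (h : α.cycleType = Multiset.replicate n 2) : IsPerfectMatching α := by
  have : Fact (Nat.Prime 2) := ⟨Nat.prime_two⟩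
  rw [isPerfectMatching_iff]
  constructor
  · have h2 : α ^ 2 = 1 := by
      rw [Perm.pow_prime_eq_one_iff, h]
      intro c hc
      exact Multiset.eq_of_mem_replicate hc
    intro x
    have := congrArg (fun σ => σ x) h2
    simpa [pow_two] using this
  · have h5 := α.sum_cycleType
    rw [h] at h5
    have h6 : α.support = Finset.univ := by
      rw [← Finset.card_eq_iff_eq_univ, ← h5]
      simp [mul_comm]
    intro x
    have : x ∈ α.support := by simp [h6]
    simpa using this

theorem numMatchings_odd (n : ℕ) : numMatchings (2 * n + 1) = 0 := by
  have : IsEmpty {α : Perm (Fin (2 * n + 1)) // IsPerfectMatching α} :=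
    ⟨fun ⟨α, h⟩ => by
      obtain ⟨k, hk, -⟩ := h.cycleType
      omega⟩
  exact Nat.card_of_isEmpty

/-- The conjugacy class of cycle type `2ⁿ` has `(2n)! / (2ⁿ n!)` elements, and `2ⁿ n! = (2n)‼`. -/
theorem numMatchings_even (n : ℕ) : numMatchings (2 * n) = (2 * n - 1)‼ := by
  have h1 : numMatchings (2 * n) = Finset.card
      (Finset.univ.filter fun α : Perm (Fin (2 * n)) => α.cycleType = Multiset.replicate n 2) := by
    classical
    rw [numMatchings, Nat.card_eq_fintype_card, Fintype.card_subtype]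
    congr 1
    ext α
    simp only [Finset.mem_filter, Finset.mem_univ, true_and]
    refine ⟨fun h => ?_, isPerfectMatching_of_cycleType⟩
    obtain ⟨k, hk, h⟩ := h.cycleType
    rw [h, show k = n by omega]
  have h2 := Perm.card_of_cycleType_mul_eq (Fin (2 * n)) (Multiset.replicate n 2)
  rw [← h1, if_pos ⟨by simp [mul_comm], fun a ha => (Multiset.eq_of_mem_replicate ha).ge⟩] at h2
  rcases n with _ | n
  · simp at h2
    simpa using h2
  · rw [Multiset.toFinset_replicate] at h2
    simp only [Nat.add_eq_zero_iff, one_ne_zero, and_false, if_false, Finset.prod_singleton,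
      Multiset.count_replicate_self, Multiset.sum_replicate, Multiset.prod_replicate, smul_eq_mul,
      Fintype.card_fin] at h2
    rw [show 2 * (n + 1) - (n + 1) * 2 = 0 by omega, Nat.factorial_zero, one_mul,
      ← Nat.doubleFactorial_two_mul, show 2 * (n + 1) = 2 * n + 1 + 1 by ring,
      Nat.factorial_eq_mul_doubleFactorial, mul_comm] at h2
    exact Nat.eq_of_mul_eq_mul_left (Nat.doubleFactorial_pos _) h2

theorem cast_numMatchings_even (n : ℕ) : (numMatchings (2 * n) : ℝ) = matchSeq n := by
  rw [numMatchings_even, matchSeq]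

/-! ### Decomposition of perfect matchings at the first invariant initial segment -/

/-- `α` maps the initial segment of length `k` to itself. -/
def PreservesInitial {n : ℕ} (α : Perm (Fin n)) (k : ℕ) : Prop :=
  ∀ i : Fin n, (i : ℕ) < k → (α i : ℕ) < k

theorem image_initial_eq_iff {n : ℕ} (α : Perm (Fin n)) (k : ℕ) :
    α '' {i : Fin n | (i : ℕ) < k} = {i : Fin n | (i : ℕ) < k} ↔ PreservesInitial α k := by
  constructor
  · intro h i hi
    have : α i ∈ α '' {i : Fin n | (i : ℕ) < k} := ⟨i, hi, rfl⟩
    rwa [h] at this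
  · intro h
    refine Set.eq_of_subset_of_ncard_le ?_ ?_ (Set.toFinite _)
    · rintro _ ⟨i, hi, rfl⟩
      exact h i hi
    · rw [Set.ncard_image_of_injective _ α.injective]

theorem isIndecomposable_iff {n : ℕ} (α : Perm (Fin n)) :
    IsIndecomposable α ↔ ∀ k, 0 < k → k < n → ¬ PreservesInitial α k := by
  simp [IsIndecomposable, image_initial_eq_iff]

/-- The shortest nonempty invariant initial segment has length `k`. -/
def IsFirstReturn {n : ℕ} (α : Perm (Fin n)) (k : ℕ) : Prop :=
  0 < k ∧ PreservesInitial α k ∧ ∀ j, 0 < j → j < k → ¬ PreservesInitial α j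

theorem preservesInitial_blockPerm {k m j : ℕ} (β : Perm (Fin k)) (γ : Perm (Fin m)) (hj : j ≤ k) :
    PreservesInitial (blockPerm finSumFinEquiv β γ) j ↔ PreservesInitial β j := by
  unfold PreservesInitial
  rw [finSumFinEquiv.surjective.forall, Sum.forall]
  simp only [blockPerm_inl, blockPerm_inr]
  simp only [finSumFinEquiv_apply_left, finSumFinEquiv_apply_right, Fin.val_castAdd, Fin.val_natAdd,
    and_iff_left_iff_imp]
  intro _ b hb
  omega

theorem card_isFirstReturn {k m : ℕ} (hk : 0 < k) :
    Nat.card {α : Perm (Fin (k + m)) // IsPerfectMatching α ∧ IsFirstReturn α k} =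
      im k * numMatchings m := by
  rw [im, numMatchings, ← Nat.card_prod]
  refine (Nat.card_congr (Equiv.ofBijective
    (fun p => ⟨blockPerm finSumFinEquiv p.1.1 p.2.1,
      (isPerfectMatching_blockPerm _ _ _).2 ⟨p.1.2.1, p.2.2⟩, hk,
      (preservesInitial_blockPerm _ _ le_rfl).2 fun i _ => (p.1.1 i).2, fun j hj hjk =>
      (preservesInitial_blockPerm _ _ hjk.le).not.2
        ((isIndecomposable_iff _).1 p.1.2.2 j hj hjk)⟩) ⟨?_, ?_⟩)).symm
  · rintro ⟨⟨β, hβ⟩, ⟨γ, hγ⟩⟩ ⟨⟨β', hβ'⟩, ⟨γ', hγ'⟩⟩ h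
    obtain ⟨rfl, rfl⟩ := blockPerm_inj _ (congrArg Subtype.val h)
    rfl
  · rintro ⟨α, hα, -, h1, h2⟩
    obtain ⟨β, γ, rfl⟩ := exists_eq_blockPerm finSumFinEquiv α fun a => by
      have := h1 (finSumFinEquiv (Sum.inl a)) (by simp)
      exact ⟨⟨_, this⟩, by ext; simp⟩
    rw [isPerfectMatching_blockPerm] at hα
    refine ⟨⟨⟨β, hα.1, (isIndecomposable_iff _).2 fun j hj hjk => ?_⟩, ⟨γ, hα.2⟩⟩, rfl⟩
    rw [← preservesInitial_blockPerm β γ hjk.le]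
    exact h2 j hj hjk

/-- Up to its first return a matching is indecomposable, and after it arbitrary; the index `j`
stands for a first return at `j + 1`. -/
theorem numMatchings_eq_sum {n : ℕ} (hn : 0 < n) :
    numMatchings n = ∑ j ∈ Finset.range n, im (j + 1) * numMatchings (n - 1 - j) := by
  classical
  rw [numMatchings, card_subtype_eq_sum (Finset.range n) _ fun j α => IsFirstReturn α (j + 1)]
  · refine Finset.sum_congr rfl fun j hj => ?_
    rw [Finset.mem_range] at hj
    obtain ⟨m, rfl⟩ : ∃ m, n = (j + 1) + m := ⟨n - (j + 1), by omega⟩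
    rw [card_isFirstReturn (Nat.succ_pos j), show j + 1 + m - 1 - j = m by omega]
  · intro α _
    have hex : ∃ k, 0 < k ∧ PreservesInitial α k := ⟨n, hn, fun i _ => (α i).2⟩
    have hle : Nat.find hex ≤ n := Nat.find_min' hex ⟨hn, fun i _ => (α i).2⟩
    have hpos := (Nat.find_spec hex).1
    refine ⟨Nat.find hex - 1, ⟨by simp; omega, ?_⟩, ?_⟩
    · rw [Nat.sub_add_cancel hpos]
      exact ⟨hpos, (Nat.find_spec hex).2, fun j hj hjk h => Nat.find_min hex hjk ⟨hj, h⟩⟩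
    · rintro j ⟨-, -, h1, h2⟩
      have h3 : Nat.find hex ≤ j + 1 := Nat.find_min' hex ⟨Nat.succ_pos j, h1⟩
      have h4 : ¬ Nat.find hex < j + 1 := fun h => h2 _ hpos h (Nat.find_spec hex).2
      omega

theorem im_le_numMatchings (n : ℕ) : im n ≤ numMatchings n :=
  Nat.card_le_card_of_injective (fun α => ⟨α.1, α.2.1⟩) fun _ _ h =>
    Subtype.ext (Subtype.mk.inj h)

theorem im_odd (n : ℕ) : im (2 * n + 1) = 0 :=
  Nat.le_zero.1 ((im_le_numMatchings _).trans (numMatchings_odd n).le)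

theorem im_even_le (n : ℕ) : (im (2 * n) : ℝ) ≤ matchSeq n := by
  rw [← cast_numMatchings_even]
  exact_mod_cast im_le_numMatchings _

/-- Without this a term of the expansion would vanish identically, and the error `O(f (r + 1))`
would demand an exact equality. The witness exchanges `i` and `n + i`: an invariant segment contains
the partner `n` of `0`, and if its length `k` satisfies `n < k < 2n` it would contain `k`, the
partner of `k - n`. -/
theorem im_even_pos {n : ℕ} (hn : 0 < n) : 0 < im (2 * n) := by
  have : Nonempty {α : Perm (Fin (n + n)) // IsPerfectMatching α ∧ IsIndecomposable α} := by
    set α : Perm (Fin (n + n)) := finSumFinEquiv.permCongr (Equiv.sumComm (Fin n) (Fin n)) with hα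
    have hl : ∀ i, α (finSumFinEquiv (Sum.inl i)) = finSumFinEquiv (Sum.inr i) := fun i => by
      rw [hα, Equiv.permCongr_apply, Equiv.symm_apply_apply]
      rfl
    have hr : ∀ i, α (finSumFinEquiv (Sum.inr i)) = finSumFinEquiv (Sum.inl i) := fun i => by
      rw [hα, Equiv.permCongr_apply, Equiv.symm_apply_apply]
      rfl
    refine ⟨α, ?_, ?_⟩
    · rw [isPerfectMatching_iff]
      simp only [Function.Involutive, finSumFinEquiv.surjective.forall, Sum.forall, hl, hr, ne_eq,
        finSumFinEquiv.injective.eq_iff, reduceCtorEq, not_false_eq_true, implies_true, and_self]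
    · rw [isIndecomposable_iff]
      intro k hk hkn h
      have h1 := h (finSumFinEquiv (Sum.inl ⟨0, hn⟩)) (by simpa using hk)
      rw [hl] at h1
      simp only [finSumFinEquiv_apply_right, Fin.val_natAdd, add_zero] at h1
      have h3 : finSumFinEquiv (Sum.inr ⟨k - n, by omega⟩) ∈ {i : Fin (n + n) | (i : ℕ) < k} := by
        rw [← (image_initial_eq_iff _ k).2 h]
        refine ⟨finSumFinEquiv (Sum.inl ⟨k - n, by omega⟩), ?_, hl _⟩
        simp
        omega
      simp at h3
      omega
  rw [two_mul]
  exact Nat.card_pos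

theorem matchSeq_eq_sum_im {n : ℕ} (hn : 0 < n) :
    matchSeq n = ∑ i ∈ Finset.range n, (im (2 * (i + 1)) : ℝ) * matchSeq (n - (i + 1)) := by
  rw [← cast_numMatchings_even, numMatchings_eq_sum (by omega), sum_range_two_mul]
  · push_cast
    refine Finset.sum_congr rfl fun i hi => ?_
    rw [← cast_numMatchings_even, show 2 * n - 1 - (2 * i + 1) = 2 * (n - (i + 1)) by omega]
    rfl
  · intro i
    rw [im_odd, zero_mul]

end MapAsymptotics

namespace MapAsymptotics

open Equiv

/-! ### Combinatorial maps and their connected components -/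

/-- The set `S` is stable under both permutations of the map. -/
def CombinatorialMap.Stable {n : ℕ} (m : CombinatorialMap n) (S : Set (Fin n)) : Prop :=
  ∀ i ∈ S, m.σ i ∈ S ∧ m.α i ∈ S

/-- The set `S` is the connected component of `x`. -/
def CombinatorialMap.IsComponent {n : ℕ} (m : CombinatorialMap n) (x : Fin n)
    (S : Set (Fin n)) : Prop :=
  x ∈ S ∧ m.Stable S ∧ ∀ T, x ∈ T → m.Stable T → S ⊆ T

/-- Forward stability suffices: on a finite set an injection of `S` into itself is onto, so inverses
preserve `S` as well. -/
theorem CombinatorialMap.Stable.smul_eq {n : ℕ} {m : CombinatorialMap n} {S : Set (Fin n)}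
    (hS : m.Stable S) {g : Perm (Fin n)} (hg : g ∈ Subgroup.closure {m.σ, m.α}) : g '' S = S := by
  induction hg using Subgroup.closure_induction with
  | mem g hg =>
    refine Set.eq_of_subset_of_ncard_le ?_ ?_ (Set.toFinite _)
    · rintro _ ⟨i, hi, rfl⟩
      rcases hg with rfl | rfl
      · exact (hS i hi).1
      · exact (hS i hi).2
    · rw [Set.ncard_image_of_injective _ g.injective]
  | one => simp
  | mul g h _ _ hg hh => rw [Perm.coe_mul, Set.image_comp, hh, hg]
  | inv g _ hg =>
    conv_lhs => rw [← hg]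
    rw [← Set.image_comp, ← Perm.coe_mul, inv_mul_cancel]
    simp

theorem CombinatorialMap.isConnected_iff {n : ℕ} (m : CombinatorialMap n) (x : Fin n) :
    m.IsConnected ↔ ∀ T, x ∈ T → m.Stable T → T = Set.univ := by
  constructor
  · rintro ⟨-, h⟩ T hx hT
    refine Set.eq_univ_of_forall fun y => ?_
    obtain ⟨⟨g, hg⟩, rfl⟩ := h.exists_smul_eq x y
    rw [← hT.smul_eq hg]
    exact ⟨x, hx, rfl⟩
  · intro h
    refine ⟨x.pos, ?_⟩
    have horb : MulAction.orbit (Subgroup.closure {m.σ, m.α}) x = Set.univ := by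
      refine h _ (MulAction.mem_orbit_self x) ?_
      rintro _ ⟨⟨g, hg⟩, rfl⟩
      exact ⟨⟨⟨m.σ * g, mul_mem (Subgroup.subset_closure (by simp)) hg⟩, rfl⟩,
        ⟨⟨m.α * g, mul_mem (Subgroup.subset_closure (by simp)) hg⟩, rfl⟩⟩
    refine ⟨fun y z => ?_⟩
    obtain ⟨g, rfl⟩ : y ∈ MulAction.orbit (Subgroup.closure {m.σ, m.α}) x := horb ▸ Set.mem_univ y
    obtain ⟨g', rfl⟩ : z ∈ MulAction.orbit (Subgroup.closure {m.σ, m.α}) x := horb ▸ Set.mem_univ z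
    exact ⟨g' * g⁻¹, by simp [mul_smul]⟩

theorem CombinatorialMap.existsUnique_isComponent {n : ℕ} (m : CombinatorialMap n) (x : Fin n) :
    ∃! S, m.IsComponent x S := by
  refine ⟨⋂₀ {T | x ∈ T ∧ m.Stable T}, ⟨?_, ?_, ?_⟩, ?_⟩
  · exact fun T hT => hT.1
  · exact fun i hi => ⟨fun T hT => (hT.2 i (hi T hT)).1, fun T hT => (hT.2 i (hi T hT)).2⟩
  · exact fun T hx hT => Set.sInter_subset_of_mem ⟨hx, hT⟩
  · rintro S ⟨hx, hS, hmin⟩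
    exact (Set.subset_sInter fun T hT => hmin T hT.1 hT.2).antisymm
      (Set.sInter_subset_of_mem ⟨hx, hS⟩)

/-- The number of connected combinatorial maps of size `n`. -/
noncomputable def numConnected (n : ℕ) : ℕ :=
  Nat.card {m : CombinatorialMap n // m.IsConnected}

theorem card_combinatorialMap (n : ℕ) : Nat.card (CombinatorialMap n) = n ! * numMatchings n := by
  rw [numMatchings, ← Nat.card_fin n, ← Nat.card_perm, ← Nat.card_prod, Nat.card_fin]
  exact Nat.card_congr
    { toFun := fun m => (m.σ, ⟨m.α, m.isPerfectMatching⟩)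
      invFun := fun p => ⟨p.1, p.2.1, p.2.2⟩
      left_inv := fun _ => rfl
      right_inv := fun _ => rfl }

/-- The disjoint union of two combinatorial maps. -/
def CombinatorialMap.disjUnion {k l n : ℕ} (e : Fin k ⊕ Fin l ≃ Fin n) (m : CombinatorialMap k)
    (m' : CombinatorialMap l) : CombinatorialMap n where
  σ := blockPerm e m.σ m'.σ
  α := blockPerm e m.α m'.α
  isPerfectMatching :=
    (isPerfectMatching_blockPerm _ _ _).2 ⟨m.isPerfectMatching, m'.isPerfectMatching⟩

theorem CombinatorialMap.isComponent_disjUnion {k l n : ℕ} (e : Fin k ⊕ Fin l ≃ Fin n)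
    (m : CombinatorialMap k) (m' : CombinatorialMap l) (a : Fin k) :
    (disjUnion e m m').IsComponent (e (Sum.inl a)) (Set.range (e ∘ Sum.inl)) ↔
      m.IsConnected := by
  rw [m.isConnected_iff a]
  constructor
  · rintro ⟨-, -, hmin⟩ T ha hT
    refine Set.eq_univ_of_forall fun b => ?_
    obtain ⟨c, hc, hcb⟩ := hmin ((e ∘ Sum.inl) '' T) ⟨a, ha, rfl⟩ (by
      rintro _ ⟨i, hi, rfl⟩
      exact ⟨⟨m.σ i, (hT i hi).1, by simp [disjUnion]⟩, ⟨m.α i, (hT i hi).2, by simp [disjUnion]⟩⟩)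
      ⟨b, rfl⟩
    obtain rfl : c = b := by simpa using hcb
    exact hc
  · intro h
    refine ⟨⟨a, rfl⟩, ?_, fun T ha hT => ?_⟩
    · rintro _ ⟨i, rfl⟩
      exact ⟨⟨m.σ i, by simp [disjUnion]⟩, ⟨m.α i, by simp [disjUnion]⟩⟩
    · have h1 := h ((e ∘ Sum.inl) ⁻¹' T) ha fun i hi => by
        have h2 := hT _ hi
        simp only [disjUnion, Function.comp, blockPerm_inl] at h2
        exact h2
      rintro _ ⟨b, rfl⟩
      exact h1.ge (Set.mem_univ b)

theorem card_isComponent {n k l : ℕ} (x : Fin n) (S : Finset (Fin n)) (hx : x ∈ S)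
    (hk : S.card = k) (hl : Sᶜ.card = l) :
    Nat.card {m : CombinatorialMap n // m.IsComponent x S} =
      numConnected k * Nat.card (CombinatorialMap l) := by
  set e := finSumEquivOfFinset hk hl
  have hS : (S : Set (Fin n)) = Set.range (e ∘ Sum.inl) := by
    have : (e ∘ Sum.inl) = S.orderEmbOfFin hk := by
      ext i
      simp [e]
    rw [this, Finset.range_orderEmbOfFin]
  obtain ⟨a, rfl⟩ : ∃ a, e (Sum.inl a) = x := by
    have : x ∈ (S : Set (Fin n)) := hx
    rw [hS] at this
    exact this
  rw [numConnected, ← Nat.card_prod, hS]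
  refine (Nat.card_congr (Equiv.ofBijective
    (fun p => ⟨CombinatorialMap.disjUnion e p.1.1 p.2,
      (CombinatorialMap.isComponent_disjUnion e _ _ a).2 p.1.2⟩) ⟨?_, ?_⟩)).symm
  · rintro ⟨⟨m, hm⟩, m'⟩ ⟨⟨p, hp⟩, p'⟩ h
    have h := Subtype.mk.inj h
    obtain ⟨h1, h2⟩ := blockPerm_inj e (congrArg CombinatorialMap.σ h)
    obtain ⟨h3, h4⟩ := blockPerm_inj e (congrArg CombinatorialMap.α h)
    obtain rfl := CombinatorialMap.ext h1 h3
    obtain rfl := CombinatorialMap.ext h2 h4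
    rfl
  · rintro ⟨m, hm⟩
    have hst : ∀ i, (∃ j, m.σ (e (Sum.inl i)) = e (Sum.inl j)) ∧
        ∃ j, m.α (e (Sum.inl i)) = e (Sum.inl j) := fun i => by
      obtain ⟨⟨j, hj⟩, ⟨j', hj'⟩⟩ := hm.2.1 _ ⟨i, rfl⟩
      exact ⟨⟨j, hj.symm⟩, ⟨j', hj'.symm⟩⟩
    obtain ⟨σ, σ', h1⟩ := exists_eq_blockPerm e m.σ fun i => (hst i).1
    obtain ⟨α, α', h2⟩ := exists_eq_blockPerm e m.α fun i => (hst i).2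
    have h3 := m.isPerfectMatching
    rw [h2, isPerfectMatching_blockPerm] at h3
    obtain rfl : m = CombinatorialMap.disjUnion e ⟨σ, α, h3.1⟩ ⟨σ', α', h3.2⟩ :=
      CombinatorialMap.ext h1 h2
    exact ⟨⟨⟨_, (CombinatorialMap.isComponent_disjUnion e _ _ a).1 hm⟩, _⟩, rfl⟩

theorem card_combinatorialMap_succ (n : ℕ) :
    Nat.card (CombinatorialMap (n + 1)) = ∑ j ∈ Finset.range (n + 1),
      n.choose j * (numConnected (j + 1) * Nat.card (CombinatorialMap (n - j))) := by
  classical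
  have h1 : Nat.card (CombinatorialMap (n + 1)) =
      Nat.card {m : CombinatorialMap (n + 1) // True} :=
    Nat.card_congr (Equiv.subtypeUnivEquiv fun _ => trivial).symm
  have hcard : (Finset.univ.erase (0 : Fin (n + 1))).card = n := by simp
  -- Maps are sorted by the component of the label `0`. Since `S` records its other labels, there
  -- are `n.choose j` sets for a component of size `j + 1`.
  rw [h1, card_subtype_eq_sum (Finset.univ.erase (0 : Fin (n + 1))).powerset _
    fun S m => m.IsComponent 0 (insert 0 S : Finset (Fin (n + 1)))]
  · have h2 := Finset.sum_powerset_apply_card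
      (fun j => numConnected (j + 1) * Nat.card (CombinatorialMap (n - j)))
      (x := Finset.univ.erase (0 : Fin (n + 1)))
    rw [hcard] at h2
    simp only [smul_eq_mul] at h2
    rw [← h2]
    refine Finset.sum_congr rfl fun S hS => ?_
    have h0 : (0 : Fin (n + 1)) ∉ S := fun h => by
      simpa using Finset.mem_powerset.1 hS h
    have hSc : (insert 0 S).card = S.card + 1 := Finset.card_insert_of_notMem h0
    simp only [true_and]
    refine card_isComponent 0 _ (Finset.mem_insert_self _ _) hSc ?_
    rw [Finset.card_compl, hSc, Fintype.card_fin]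
    omega
  · intro m _
    obtain ⟨S, hS, huniq⟩ := m.existsUnique_isComponent 0
    have h0 : 0 ∈ S.toFinset := by simpa using hS.1
    refine ⟨S.toFinset.erase 0, ⟨?_, ?_⟩, ?_⟩
    · rw [Finset.mem_powerset]
      exact Finset.erase_subset_erase _ (Finset.subset_univ _)
    · rw [Finset.insert_erase h0, Set.coe_toFinset]
      exact hS
    · rintro T ⟨hT, hT'⟩
      have h0' : (0 : Fin (n + 1)) ∉ T := fun h => by
        simpa using Finset.mem_powerset.1 hT h
      have h3 := huniq _ hT'
      rw [← Finset.erase_insert h0']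
      congr 1
      rw [← Finset.coe_inj, h3, Set.coe_toFinset]

theorem numConnected_odd (n : ℕ) : numConnected (2 * n + 1) = 0 := by
  refine Nat.le_zero.1 ((Finite.card_subtype_le _).trans ?_)
  rw [card_combinatorialMap, numMatchings_odd, mul_zero]

/-- Coefficient form of `x A' = x L' A`: the recurrence on the component of `0`, divided by `2 (2n +
1)!` in size `2n + 2`; odd components do not occur. -/
theorem mul_matchSeq_eq_sum (n : ℕ) : (n : ℝ) * matchSeq n = ∑ k ∈ Finset.range (n + 1),
    (k : ℝ) * ((numConnected (2 * k) : ℝ) / ((2 * k)! : ℝ)) * matchSeq (n - k) := by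
  rcases n with _ | n
  · simp
  have h := card_combinatorialMap_succ (2 * n + 1)
  rw [show 2 * n + 1 + 1 = 2 * (n + 1) by ring, sum_range_two_mul _ _ fun i => by
    rw [numConnected_odd, zero_mul, mul_zero], card_combinatorialMap] at h
  have h := congrArg (Nat.cast : ℕ → ℝ) h
  push_cast at h
  rw [cast_numMatchings_even] at h
  rw [Finset.sum_range_succ', Nat.cast_zero, zero_mul, zero_mul, add_zero]
  have hf : ((2 * n + 1)! : ℝ) ≠ 0 := by positivity
  have h2 : ((2 * (n + 1))! : ℝ) = 2 * (n + 1) * ((2 * n + 1)! : ℝ) := by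
    rw [show 2 * (n + 1) = 2 * n + 1 + 1 by ring, Nat.factorial_succ]
    push_cast
    ring
  refine mul_left_cancel₀ (mul_ne_zero two_ne_zero hf) ?_
  push_cast
  rw [show 2 * ((2 * n + 1)! : ℝ) * (((n : ℝ) + 1) * matchSeq (n + 1)) =
    2 * (n + 1) * ((2 * n + 1)! : ℝ) * matchSeq (n + 1) by ring, ← h2, h, Finset.mul_sum]
  refine Finset.sum_congr rfl fun i hi => ?_
  rw [Finset.mem_range] at hi
  rw [show 2 * n - 2 * i = 2 * (n - i) by omega, card_combinatorialMap]
  push_cast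
  rw [cast_numMatchings_even, Nat.cast_choose ℝ (show 2 * i + 1 ≤ 2 * n + 1 by omega),
    show 2 * n + 1 - (2 * i + 1) = 2 * (n - i) by omega,
    show 2 * (i + 1) = 2 * i + 1 + 1 by ring, Nat.factorial_succ (2 * i + 1)]
  have h3 : ((2 * i + 1)! : ℝ) ≠ 0 := by positivity
  have h4 : ((2 * (n - i))! : ℝ) ≠ 0 := by positivity
  have h5 : ((i : ℝ) + 1) ≠ 0 := by positivity
  push_cast
  rw [show (2 * (i : ℝ) + 1 + 1) = 2 * (i + 1) by ring]
  field_simp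

theorem probConnected_two_mul (n : ℕ) : probConnected (2 * n) =
    ((numConnected (2 * n) : ℝ) / ((2 * n)! : ℝ)) / matchSeq n := by
  rw [probConnected, card_combinatorialMap, numConnected, Nat.cast_mul, cast_numMatchings_even,
    div_div]

/-! ### Linear matchings -/

/-- The linear order for which `ρ` is increasing. -/
def linOrdOfPerm {n : ℕ} (ρ : Perm (Fin n)) : LinOrd n :=
  ⟨fun i j => ρ i < ρ j,
    { trichotomous := fun _ _ h1 h2 => ρ.injective (le_antisymm (not_lt.1 h2) (not_lt.1 h1))
      irrefl := fun _ => lt_irrefl _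
      trans := fun _ _ _ => lt_trans }⟩

/-- A finite linear order is rigid: `ρ' ∘ ρ⁻¹` is an order automorphism of `Fin n`, hence the
identity. -/
theorem linOrdOfPerm_injective (n : ℕ) : Function.Injective (linOrdOfPerm (n := n)) := by
  intro ρ ρ' h
  have h1 : ∀ i j, ρ i < ρ j ↔ ρ' i < ρ' j := fun i j =>
    iff_of_eq (congrFun (congrFun (congrArg Subtype.val h) i) j)
  let f : Fin n ≃o Fin n :=
    { toEquiv := ρ.symm.trans ρ'
      map_rel_iff' := fun {i j} => by
        have := h1 (ρ.symm j) (ρ.symm i)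
        simp only [Equiv.apply_symm_apply] at this
        simp only [Equiv.trans_apply]
        rw [← not_lt, ← not_lt, this] }
  ext i
  have h2 : f (ρ i) = ρ i := by rw [Subsingleton.elim f (OrderIso.refl _)]; rfl
  have h3 : f (ρ i) = ρ' i := by simp [f]
  rw [← h2, h3]

theorem exists_equiv_fin_of_isStrictTotalOrder {X : Type*} [Fintype X] (r : X → X → Prop)
    [IsStrictTotalOrder X r] {n : ℕ} (h : Fintype.card X = n) :
    ∃ f : X ≃ Fin n, ∀ i j, f i < f j ↔ r i j := by
  classical
  let inst : LinearOrder X := linearOrderOfSTO r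
  exact ⟨(Fintype.orderIsoFinOfCardEq X h).symm.toEquiv, fun i j =>
    (Fintype.orderIsoFinOfCardEq X h).symm.lt_iff_lt⟩

theorem linOrdOfPerm_surjective (n : ℕ) : Function.Surjective (linOrdOfPerm (n := n)) := by
  rintro ⟨r, hr⟩
  obtain ⟨f, hf⟩ := exists_equiv_fin_of_isStrictTotalOrder r (Fintype.card_fin n)
  exact ⟨f, Subtype.ext (funext fun i => funext fun j => propext (hf i j))⟩

theorem eq_initial_of_lt {n : ℕ} (U : Set (Fin n)) (hU : U.Nonempty) (hUc : Uᶜ.Nonempty)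
    (h : ∀ a ∈ U, ∀ b ∉ U, a < b) :
    ∃ k, 0 < k ∧ k < n ∧ U = {i : Fin n | (i : ℕ) < k} := by
  obtain ⟨b, hb, hmin⟩ := Set.exists_min_image Uᶜ id (Set.toFinite _) hUc
  obtain ⟨a, ha⟩ := hU
  refine ⟨b, lt_of_le_of_lt (Nat.zero_le _) (h a ha b hb), b.2, ?_⟩
  ext i
  refine ⟨fun hi => h i hi b hb, fun hi => ?_⟩
  by_contra hiU
  exact absurd (hmin i hiU) (not_le.2 hi)

/-- The lower part `A` is initial for both orders, so `ρ` and `α * ρ` send it to initial segments.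
These have equal cardinality, so they coincide and `α` preserves them. -/
theorem isReducible_iff {n : ℕ} (ρ α : Perm (Fin n)) :
    IsReducible (linOrdOfPerm ρ, linOrdOfPerm (α * ρ)) ↔ ¬ IsIndecomposable α := by
  unfold IsIndecomposable
  rw [not_not]
  constructor
  · rintro ⟨A, B, ⟨a, ha⟩, ⟨b, hb⟩, hAB, h⟩
    have key : ∀ τ : Perm (Fin n), (∀ a ∈ A, ∀ b ∈ B, τ a < τ b) →
        ∃ k, 0 < k ∧ k < n ∧ τ '' A = {i : Fin n | (i : ℕ) < k} := by
      intro τ hτ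
      refine eq_initial_of_lt _ ⟨_, a, ha, rfl⟩ ⟨τ b, ?_⟩ ?_
      · rintro ⟨c, hc, hcb⟩
        rw [τ.injective hcb] at hc
        exact Set.disjoint_left.1 hAB.disjoint hc hb
      · rintro _ ⟨c, hc, rfl⟩ d hd
        obtain ⟨d, rfl⟩ := τ.surjective d
        refine hτ c hc d ?_
        rw [← hAB.compl_eq]
        exact fun hdA => hd ⟨d, hdA, rfl⟩
    obtain ⟨k, hk, hkn, hk'⟩ := key ρ fun a ha b hb => (h a ha b hb).1
    obtain ⟨l, hl, hln, hl'⟩ := key (α * ρ) fun a ha b hb => (h a ha b hb).2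
    refine ⟨k, hk, hkn, ?_⟩
    rw [Perm.coe_mul, Set.image_comp, hk'] at hl'
    have hcard : ∀ j, j < n → {i : Fin n | (i : ℕ) < j}.ncard = j := fun j hj => by
      have : {i : Fin n | (i : ℕ) < j} = (Finset.Iio (⟨j, hj⟩ : Fin n) : Set (Fin n)) := by
        ext i
        simp [Fin.lt_def]
      rw [this, Set.ncard_coe_finset, Fin.card_Iio]
    have h1 := congrArg Set.ncard hl'
    rw [Set.ncard_image_of_injective _ α.injective, hcard k hkn, hcard l hln] at h1
    rw [hl', h1]
  · rintro ⟨k, hk, hkn, hα⟩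
    have hstab : ∀ i, (α i : ℕ) < k ↔ (i : ℕ) < k := fun i => by
      constructor
      · intro hi
        have : α i ∈ α '' {i : Fin n | (i : ℕ) < k} := by rw [hα]; exact hi
        obtain ⟨j, hj, hji⟩ := this
        rwa [α.injective hji] at hj
      · exact (image_initial_eq_iff α k).1 hα i
    refine ⟨{i | (ρ i : ℕ) < k}, {i | (ρ i : ℕ) < k}ᶜ, ⟨ρ.symm ⟨0, by omega⟩, by simpa using hk⟩,
      ⟨ρ.symm ⟨k, hkn⟩, by simp⟩, isCompl_compl, fun a ha b hb => ?_⟩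
    have ha' : (ρ a : ℕ) < k := ha
    have hb' : ¬ (ρ b : ℕ) < k := hb
    have ha2 := (hstab (ρ a)).2 ha'
    have hb2 := (hstab (ρ b)).not.2 hb'
    refine ⟨Fin.lt_def.2 ?_, Fin.lt_def.2 ?_⟩
    · omega
    · simp only [Perm.mul_apply]
      omega

theorem isLinearMatching_iff {n : ℕ} (ρ α : Perm (Fin n)) :
    IsLinearMatching (linOrdOfPerm ρ, linOrdOfPerm (α * ρ)) ↔ IsPerfectMatching α := by
  rw [isPerfectMatching_iff]
  constructor
  · rintro ⟨τ, hinv, hne, -, h2⟩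
    have h3 : linOrdOfPerm (ρ * τ) = linOrdOfPerm (α * ρ) :=
      Subtype.ext (funext fun i => funext fun j => propext (h2 i j))
    -- By rigidity `τ` is determined by the two orders and is conjugate to `α`, so both are
    -- fixed-point-free involutions or neither is.
    have h4 : α = ρ * τ * ρ⁻¹ := by
      rw [linOrdOfPerm_injective n h3, mul_inv_cancel_right]
    subst h4
    refine ⟨fun i => ?_, fun i => ?_⟩
    · simp [hinv _]
    · simp only [Perm.mul_apply, ne_eq]
      rw [← Perm.eq_inv_iff_eq]
      exact hne _
  · rintro ⟨hinv, hne⟩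
    refine ⟨ρ⁻¹ * α * ρ, fun i => ?_, fun i => ?_, fun i j => ?_, fun i j => ?_⟩
    · simp [hinv _]
    · simp only [Perm.mul_apply, ne_eq, Perm.inv_eq_iff_eq]
      exact hne _
    · simp [linOrdOfPerm, hinv _]
    · simp [linOrdOfPerm]

theorem ilm_eq (n : ℕ) : ilm n = n ! * im n := by
  rw [ilm, im, ← Nat.card_fin n, ← Nat.card_perm, ← Nat.card_prod, Nat.card_fin]
  refine (Nat.card_congr (Equiv.ofBijective
    (fun p => ⟨(linOrdOfPerm p.1, linOrdOfPerm (p.2.1 * p.1)),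
      (isLinearMatching_iff _ _).2 p.2.2.1, (isReducible_iff _ _).not.2
        (not_not.2 p.2.2.2)⟩) ⟨?_, ?_⟩)).symm
  · rintro ⟨ρ, ⟨α, hα⟩⟩ ⟨ρ', ⟨α', hα'⟩⟩ h
    obtain ⟨h1, h2⟩ := Prod.mk.inj (Subtype.mk.inj h)
    obtain rfl := linOrdOfPerm_injective n h1
    obtain rfl := mul_right_cancel (linOrdOfPerm_injective n h2)
    rfl
  · rintro ⟨⟨L, L'⟩, h1, h2⟩
    obtain ⟨ρ, rfl⟩ := linOrdOfPerm_surjective n L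
    obtain ⟨ρ', rfl⟩ := linOrdOfPerm_surjective n L'
    obtain ⟨α, rfl⟩ : ∃ α, ρ' = α * ρ := ⟨ρ' * ρ⁻¹, by simp⟩
    rw [isLinearMatching_iff] at h1
    rw [isReducible_iff, not_not] at h2
    exact ⟨⟨ρ, ⟨α, h1, h2⟩⟩, rfl⟩

/-! ### The asymptotic expansion -/

theorem isBigO_numConnected {R : ℕ} (hR : 0 < R) :
    (fun n => (numConnected (2 * n) : ℝ) / ((2 * n)! : ℝ) - ∑ k ∈ Finset.range R,
      (if k = 0 then 1 else -(im (2 * k) : ℝ)) * matchSeq (n - k)) =O[atTop]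
      fun n => matchSeq (n - R) := by
  refine isBigO_log_coeff (fun n => ?_) (fun n => ?_) mul_matchSeq_eq_sum hR
  · split_ifs with h
    · simp [h, matchSeq_zero]
    · rw [abs_neg, abs_of_nonneg (Nat.cast_nonneg _)]
      exact im_even_le n
  · rw [Finset.sum_range_succ']
    rcases n.eq_zero_or_pos with rfl | hn
    · simp [matchSeq_zero]
    · rw [if_neg hn.ne', if_pos rfl, one_mul, Nat.sub_zero, matchSeq_eq_sum_im hn,
        ← Finset.sum_add_distrib]
      exact Finset.sum_eq_zero fun i _ => by simp

theorem hasAsymptoticExpansion_probConnected :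
    HasAsymptoticExpansion (fun n => probConnected (2 * n)) 0
      (fun k n => if k = 0 then 1 else -((im (2 * k) : ℝ) * (matchSeq (n - k) / matchSeq n))) := by
  have hterm : ∀ k n, (if k = 0 then (1 : ℝ) else
      -((im (2 * k) : ℝ) * (matchSeq (n - k) / matchSeq n))) =
      (if k = 0 then 1 else -(im (2 * k) : ℝ)) * matchSeq (n - k) / matchSeq n := by
    intro k n
    split_ifs with h
    · rw [h, Nat.sub_zero, one_mul, div_self (matchSeq_pos n).ne']
    · ring
  -- Nonzero coefficients let bounds in terms of `matchSeq (n - k)` be restated in terms of the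
  -- expansion's own terms.
  have hne : ∀ k, (if k = 0 then (1 : ℝ) else -(im (2 * k) : ℝ)) ≠ 0 := by
    intro k
    split_ifs with h
    · exact one_ne_zero
    · have := im_even_pos (Nat.pos_of_ne_zero h)
      exact neg_ne_zero.2 (by exact_mod_cast this.ne')
  simp_rw [hterm]
  set b : ℕ → ℝ := fun k => if k = 0 then (1 : ℝ) else -(im (2 * k) : ℝ) with hb
  refine ⟨fun r _ => ?_, fun k _ => ?_⟩
  · have h1 := (isBigO_numConnected (Nat.succ_pos r)).mul
      (isBigO_refl (fun n => (matchSeq n)⁻¹) atTop)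
    refine (h1.congr_left fun n => ?_).trans ?_
    · dsimp only
      rw [probConnected_two_mul, sub_mul, Finset.sum_mul, ← Nat.range_succ_eq_Icc_zero]
      rfl
    · have h2 := isBigO_const_mul_self (b (r + 1))⁻¹
        (fun n => b (r + 1) * matchSeq (n - (r + 1)) / matchSeq n) atTop
      refine h2.congr_left fun n => ?_
      have := hne (r + 1)
      rw [div_eq_mul_inv, mul_assoc, inv_mul_cancel_left₀ this]
  · have h1 : (fun n => matchSeq (n - (k + 1))) =o[atTop] fun n => matchSeq (n - k) := by
      rw [isLittleO_iff_tendsto fun n h => absurd h (matchSeq_pos _).ne']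
      refine (tendsto_matchSeq_ratio.comp (tendsto_sub_atTop_nat (k + 1))).congr' ?_
      filter_upwards [eventually_ge_atTop (k + 1)] with n hn
      simp only [Function.comp]
      rw [show n - (k + 1) + 1 = n - k by omega]
    have h2 := ((h1.const_mul_left (b (k + 1))).trans_isBigO
      ((isBigO_refl _ _).const_mul_right (hne k))).mul_isBigO
      (isBigO_refl (fun n => (matchSeq n)⁻¹) atTop)
    simpa only [div_eq_mul_inv] using h2

end MapAsymptotics

open MapAsymptotics
/-- `P(connected) ≈ 1 - ∑_{k ≥ 1} g k n` is the expansion whose term of index `0` is `1` and whose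
term of index `k ≥ 1` is `-g k n`. For `n = k` the truncated `2 * (n - k) - 1` is `0`, and
`0‼ = 1 = (-1)‼`; values at `n < k` do not matter, as each condition concerns `n → ∞`. -/
theorem mainTheorem8 :
    HasAsymptoticExpansion (fun n => probConnected (2 * n)) 0
      (fun k n => if k = 0 then 1 else
        -(((ilm (2 * k) : ℝ) / ((2 * k)! : ℝ)) *
          (((2 * (n - k) - 1)‼ : ℝ) / ((2 * n - 1)‼ : ℝ)))) ∧
    HasAsymptoticExpansion (fun n => probConnected (2 * n)) 0
      (fun k n => if k = 0 then 1 else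
        -((im (2 * k) : ℝ) *
          (((2 * (n - k) - 1)‼ : ℝ) / ((2 * n - 1)‼ : ℝ)))) := by
  have h : ∀ k, (ilm (2 * k) : ℝ) / ((2 * k)! : ℝ) = im (2 * k) := fun k => by
    rw [ilm_eq, Nat.cast_mul, mul_div_cancel_left₀]
    positivity
  simp_rw [h]
  exact ⟨hasAsymptoticExpansion_probConnected, hasAsymptoticExpansion_probConnected⟩
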